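/- We work over $\mathbb{C}$. Let $V\subseteq\Gamma(\mathbb{P}^n,\mathcal{O}(2))$ be a linear system of quadrics, let $X\subseteq\mathbb{P}^n$ be its base scheme (the closed subscheme cut out by the forms in $V$), and let $\varphi:\mathbb{P}^n\dashrightarrow\mathbb{P}(V)$, $x\mapsto [F\mapsto F(x)]$, be the induced map, a morphism on $\mathbb{P}^n\setminus X$; here $\mathbb{P}(V)$ is the space of one-dimensional quotients of $V$. Let $\mathrm{Sec}\,X$ be the Zariski closure of the union of $X$ and of all lines $L\subset\mathbb{P}^n$ for which the scheme $L\cap X$ has length at least two (lines contained in $X$ included). Say that $\varphi$ is an embedding off $\mathrm{Sec}\,X$ if it separates points and tangent vectors there, that is, if $\varphi$ is injective on $\mathbb{P}^n\setminus\mathrm{Sec}\,X$ and its differential is injective at every point of $\mathbb{P}^n\setminus\mathrm{Sec}\,X$. Then the following are equivalent: (1) $\varphi$ is an embedding off $\mathrm{Sec}\,X$; (2) for every line $L\subset\mathbb{P}^n$ with $L\cap X=\emptyset$ and $L\not\subset\mathrm{Sec}\,X$, the natural restriction map $r_L:V\rightarrow\Gamma(L,\mathcal{O}_L(2))$ is surjective.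 -/

import Mathlib

open scoped LinearAlgebra.Projectivization

noncomputable section

namespace QuadricSystem

attribute [local instance] MvPolynomial.gradedAlgebra

/-- The affine cone `ℂ^{n+1}` over `ℙⁿ`. -/
abbrev Cone (n : ℕ) : Type := Fin (n + 1) → ℂ

/-- The set of (closed) points of the complex projective space `ℙⁿ`. -/
abbrev PSpace (n : ℕ) : Type := ℙ ℂ (Cone n)

/-- The homogeneous coordinate ring `ℂ[x₀, …, xₙ]` of `ℙⁿ`. -/
abbrev CoordRing (n : ℕ) : Type := MvPolynomial (Fin (n + 1)) ℂ

/-- `Γ(ℙⁿ, O(d))`: the forms of degree `d` in `n + 1` variables. -/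
abbrev Sections (n d : ℕ) : Submodule ℂ (CoordRing n) :=
  MvPolynomial.homogeneousSubmodule (Fin (n + 1)) ℂ d

/-- Closed subschemes of `ℙⁿ` are presented by homogeneous ideals `I` of the coordinate ring
(`I` stands for `Proj (ℂ[x₀, …, xₙ] / I)`; no saturation is required). -/
abbrev ProjIdeal (n : ℕ) : Type :=
  HomogeneousIdeal (MvPolynomial.homogeneousSubmodule (Fin (n + 1)) ℂ)

/-- The closed points of the subscheme defined by `I`. -/
def points {n : ℕ} (I : ProjIdeal n) : Set (PSpace n) :=
  {p | ∀ F ∈ I, MvPolynomial.eval p.rep F = 0}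

/-- The Zariski closure of a set of points of `ℙⁿ`: the points at which every form (of any
degree) that vanishes on the set vanishes. -/
def zariskiClosure {n : ℕ} (S : Set (PSpace n)) : Set (PSpace n) :=
  {p | ∀ (d : ℕ), ∀ F ∈ Sections n d, (∀ q ∈ S, MvPolynomial.eval q.rep F = 0) →
    MvPolynomial.eval p.rep F = 0}

/-! ### Lines

A line `L ⊆ ℙⁿ` is given by a parametrization `ℙ¹ → ℙⁿ`, that is, by an injective linear map
`ι : ℂ² → ℂ^{n+1}`. It identifies `O_L(d)` with `O(d)` on `ℙ¹`, so `Γ(L, O_L(d))` is the space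
`Sections 1 d` of binary forms of degree `d`. -/

/-- The set of points of the line parametrized by `ι`. -/
def linePoints {n : ℕ} (ι : Cone 1 →ₗ[ℂ] Cone n) (hι : Function.Injective ι) :
    Set (PSpace n) :=
  Set.range (Projectivization.map ι hι)

/-- Pull-back of polynomials along the parametrization: `F ↦ F ∘ ι`. -/
def pullback {n : ℕ} (ι : Cone 1 →ₗ[ℂ] Cone n) : CoordRing n →ₐ[ℂ] CoordRing 1 :=
  MvPolynomial.aeval fun i => ∑ j, MvPolynomial.C (ι (Pi.single j 1) i) * MvPolynomial.X j

lemma pullback_mem {n d : ℕ} (ι : Cone 1 →ₗ[ℂ] Cone n) {F : CoordRing n}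
    (hF : F ∈ Sections n d) : pullback ι F ∈ Sections 1 d := by
  have h := MvPolynomial.IsHomogeneous.aeval
    (g := fun i => ∑ j, MvPolynomial.C (ι (Pi.single j 1) i) * MvPolynomial.X j)
    (n := 1) (show F.IsHomogeneous d from hF) (fun i => by
      refine MvPolynomial.IsHomogeneous.sum _ _ _ fun j _ => ?_
      simpa using (MvPolynomial.isHomogeneous_C (Fin (1 + 1)) (ι (Pi.single j 1) i)).mul
        (MvPolynomial.isHomogeneous_X ℂ j))
  simpa [pullback] using h

/-- The natural restriction map `r_L : V → Γ(L, O_L(2))` for a linear system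
`V ⊆ Γ(ℙⁿ, O(2))` and the line `L` parametrized by `ι`. -/
def restrictToLine {n : ℕ} (V : Submodule ℂ (Sections n 2)) (ι : Cone 1 →ₗ[ℂ] Cone n) :
    V →ₗ[ℂ] Sections 1 2 :=
  ((pullback ι).toLinearMap ∘ₗ (Sections n 2).subtype ∘ₗ V.subtype).codRestrict
    (Sections 1 2) fun F => pullback_mem ι F.1.2

/-- The scheme-theoretic intersection `L ∩ X` has length at least two (infinite length, that is
`L ⊆ X`, included): it contains a closed subscheme of `L ≅ ℙ¹` of length two. Such subschemes are
the zero schemes of the nonzero binary quadratic forms `q`. -/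
def IsSecantLine {n : ℕ} (I : ProjIdeal n) (ι : Cone 1 →ₗ[ℂ] Cone n) : Prop :=
  ∃ q ∈ Sections 1 2, q ≠ 0 ∧ ∀ F ∈ I, q ∣ pullback ι F

/-- The secant variety `Sec X` of the subscheme `X` defined by `I`: the Zariski closure of the
union of `X` and of all the lines that meet `X` in a scheme of length at least two. (The points of
`X` lie on such lines already, unless `X` is a single reduced point.) -/
def secantVariety {n : ℕ} (I : ProjIdeal n) : Set (PSpace n) :=
  zariskiClosure (points I ∪
    {p | ∃ (ι : Cone 1 →ₗ[ℂ] Cone n) (hι : Function.Injective ι),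
      IsSecantLine I ι ∧ p ∈ linePoints ι hι})

/-! ### The rational map given by a linear system of quadrics -/

/-- The base scheme of `V`: the closed subscheme of `ℙⁿ` cut out by the members of `V`. -/
def baseScheme {n : ℕ} (V : Submodule ℂ (Sections n 2)) : ProjIdeal n :=
  ⟨Ideal.span {F | ∃ G ∈ V, (G : CoordRing n) = F}, Ideal.homogeneous_span _ _ (by
    rintro _ ⟨G, -, rfl⟩
    exact ⟨2, G.2⟩)⟩

/-- `ℙ(V)`, the space of one-dimensional quotients of `V`; the quotient `V → V / ker ℓ` is
represented by the line in the dual of `V` that `ℓ` spans. -/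
abbrev QuotSpace {n : ℕ} (V : Submodule ℂ (Sections n 2)) : Type := ℙ ℂ (Module.Dual ℂ V)

/-- The lift of `φ` to affine cones, `ℂ^{n+1} → V^*`, `x ↦ (F ↦ F(x))`. -/
def coneMap {n : ℕ} (V : Submodule ℂ (Sections n 2)) (x : Cone n) : Module.Dual ℂ V :=
  (MvPolynomial.aeval x).toLinearMap ∘ₗ (Sections n 2).subtype ∘ₗ V.subtype

/-- The derivative at `x` of `coneMap V`: `v ↦ (F ↦ ∑ i, v i * (∂F/∂xᵢ)(x))`. -/
def coneDeriv {n : ℕ} (V : Submodule ℂ (Sections n 2)) (x : Cone n) :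
    Cone n →ₗ[ℂ] Module.Dual ℂ V :=
  ∑ i, (LinearMap.proj i : Cone n →ₗ[ℂ] ℂ).smulRight
    ((MvPolynomial.aeval x).toLinearMap ∘ₗ (MvPolynomial.pderiv i).toLinearMap ∘ₗ
      (Sections n 2).subtype ∘ₗ V.subtype)

lemma coneMap_apply {n : ℕ} (V : Submodule ℂ (Sections n 2)) (x : Cone n) (F : V) :
    coneMap V x F = MvPolynomial.eval x (F : CoordRing n) := by
  simp [coneMap]

lemma coneDeriv_apply {n : ℕ} (V : Submodule ℂ (Sections n 2)) (x v : Cone n) (F : V) :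
    coneDeriv V x v F =
      ∑ i, v i * MvPolynomial.eval x (MvPolynomial.pderiv i (F : CoordRing n)) := by
  simp [coneDeriv, LinearMap.sum_apply]

/-- Euler's identity. -/
lemma coneDeriv_self {n : ℕ} (V : Submodule ℂ (Sections n 2)) (x : Cone n) :
    coneDeriv V x x = (2 : ℂ) • coneMap V x := by
  ext F
  have h := congrArg (MvPolynomial.eval x)
    (MvPolynomial.IsHomogeneous.sum_X_mul_pderiv (φ := (F : CoordRing n)) (n := 2) F.1.2)
  rw [coneDeriv_apply, LinearMap.smul_apply, coneMap_apply]
  simpa using h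

lemma coneMap_ne_zero {n : ℕ} (V : Submodule ℂ (Sections n 2)) {p : PSpace n}
    (hp : p ∉ points (baseScheme V)) : coneMap V p.rep ≠ 0 := by
  intro h
  refine hp fun F hF => ?_
  have hle : (baseScheme V).toIdeal ≤ RingHom.ker (MvPolynomial.eval p.rep) := by
    refine Ideal.span_le.2 ?_
    rintro _ ⟨G, hG, rfl⟩
    have := coneMap_apply V p.rep ⟨G, hG⟩
    rw [h] at this
    exact this.symm
  exact hle hF

/-- The map `φ : ℙⁿ ⇢ ℙ(V)` given by `V`, on the complement of the base scheme. -/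
def phi {n : ℕ} (V : Submodule ℂ (Sections n 2))
    (p : {p : PSpace n // p ∉ points (baseScheme V)}) : QuotSpace V :=
  Projectivization.mk ℂ (coneMap V p.1.rep) (coneMap_ne_zero V p.2)

/-- The differential of `φ` at `p`. The tangent space of a projective space `ℙ(E)` at the point
`ℂ x` is `E / ℂ x` (after a choice of the representative `x`), and the differential is induced by
that of the lift to affine cones. -/
def dphi {n : ℕ} (V : Submodule ℂ (Sections n 2))
    (p : {p : PSpace n // p ∉ points (baseScheme V)}) :
    (Cone n ⧸ p.1.submodule) →ₗ[ℂ] (Module.Dual ℂ V ⧸ (phi V p).submodule) :=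
  Submodule.mapQ _ _ (coneDeriv V p.1.rep) (by
    rw [Projectivization.submodule_eq, phi, Projectivization.submodule_mk,
      Submodule.span_singleton_le_iff_mem, Submodule.mem_comap, coneDeriv_self]
    exact Submodule.smul_mem _ _ (Submodule.mem_span_singleton_self _))

/-- `φ` is an embedding off `S` (where `S` contains the base locus): on `ℙⁿ \ S` it separates
points and tangent vectors. -/
def IsEmbeddingOff {n : ℕ} (V : Submodule ℂ (Sections n 2)) (S : Set (PSpace n)) : Prop :=
  Set.InjOn (phi V) {p | p.1 ∉ S} ∧ ∀ p, p.1 ∉ S → Function.Injective (dphi V p)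

end QuadricSystem

end

/-!
Restricting the quadrics of `V` to a line `L = ℙ(ι)` gives binary quadratic forms
`w₀ X₀² + w₁ X₀ X₁ + w₂ X₁²`. The argument is about the linear relations
`c₀ w₀ + c₁ w₁ + c₂ w₂ = 0` that hold for all of them (`IsRelation`); such a `c ≠ 0` exists exactly
when `r_L` is not surjective. Evaluation at `(s, t)` is the functional `(s², st, t²)`, so a relation
`c` is a point of the plane of the conic `c₀ c₂ = c₁²`, whose points are the points of `L`.

* A nonzero relation on the conic is a base point of `V` on `L`
  (`IsRelation.nondegenerate_of_disjoint`).
* Two independent relations leave at most one binary form, which then cuts out a subscheme of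
  length two of `L ∩ X` (`isSecantLine_of_isRelation`). Hence, if `L` is not contained in `Sec X`, a
  relation `c` off the conic forces `L ∩ X = ∅`: a base point would be a second relation, on the
  conic (`IsRelation.disjoint`).
* Through a relation `c` off the conic pass the secants of the conic that join `u` to its conjugate
  `σ u` under the involution that `c` defines on `L`; thus `φ` identifies `u` and `σ u`. For a
  general `u` both points are off `Sec X` and distinct, so `φ` is not injective there
  (`IsRelation.not_injOn`).

If `φ` is an embedding off `Sec X`, the first and the third item give the surjectivity of `r_L`.
Conversely, if `φ` identifies two points, or a point and a tangent vector, the line through them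
carries a relation `(1, 0, -a)` with `a ≠ 0` or `(-a, 1, 0)`, which is off the conic, so by the
second item that line violates the surjectivity of `r_L`.
-/

open scoped LinearAlgebra.Projectivization Matrix
open MvPolynomial

noncomputable section

namespace QuadricSystem

attribute [local instance] MvPolynomial.gradedAlgebra

/-! ### Forms and their values at points of projective space -/

lemma eval_smul_of_mem_sections {n d : ℕ} {F : CoordRing n} (hF : F ∈ Sections n d) (a : ℂ)
    (x : Cone n) : eval (a • x) F = a ^ d * eval x F := by
  rw [eval_eq, eval_eq, Finset.mul_sum]
  refine Finset.sum_congr rfl fun m hm => ?_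
  have hdeg : m.degree = d := by
    by_contra h
    exact (mem_support_iff.1 hm) (IsHomogeneous.coeff_eq_zero hF h)
  have : a ^ d = ∏ i ∈ m.support, a ^ m i := by
    rw [Finset.prod_pow_eq_pow_sum, ← hdeg, Finsupp.degree_apply]
  simp only [Pi.smul_apply, smul_eq_mul, mul_pow, Finset.prod_mul_distrib, this]
  ring

lemma eval_rep_mk_eq_zero_iff {n d : ℕ} {F : CoordRing n} (hF : F ∈ Sections n d) {x : Cone n}
    (hx : x ≠ 0) : eval (Projectivization.mk ℂ x hx).rep F = 0 ↔ eval x F = 0 := by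
  obtain ⟨a, ha⟩ := Projectivization.exists_smul_eq_mk_rep ℂ x hx
  rw [← ha, Units.smul_def, eval_smul_of_mem_sections hF]
  simp

lemma mk_mem_points_baseScheme {n : ℕ} {V : Submodule ℂ (Sections n 2)} {x : Cone n}
    (hx : x ≠ 0) :
    Projectivization.mk ℂ x hx ∈ points (baseScheme V) ↔
      ∀ F ∈ V, eval x (F : CoordRing n) = 0 := by
  constructor
  · intro h F hF
    exact (eval_rep_mk_eq_zero_iff F.2 hx).1 (h F (Ideal.subset_span ⟨F, hF, rfl⟩))
  · intro h
    have hle : (baseScheme V).toIdeal ≤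
        RingHom.ker (eval (Projectivization.mk ℂ x hx).rep) := by
      refine Ideal.span_le.2 ?_
      rintro _ ⟨G, hG, rfl⟩
      exact (eval_rep_mk_eq_zero_iff G.2 hx).2 (h G hG)
    exact fun F hF => hle hF

lemma points_subset_secantVariety {n : ℕ} (I : ProjIdeal n) : points I ⊆ secantVariety I :=
  fun _ hp _ _ _ h => h _ (Or.inl hp)

lemma linePoints_subset_secantVariety {n : ℕ} {I : ProjIdeal n} {ι : Cone 1 →ₗ[ℂ] Cone n}
    (hι : Function.Injective ι) (h : IsSecantLine I ι) : linePoints ι hι ⊆ secantVariety I :=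
  fun _ hp _ _ _ hF => hF _ (Or.inr ⟨ι, hι, h, hp⟩)

lemma mk_mem_linePoints {n : ℕ} {ι : Cone 1 →ₗ[ℂ] Cone n} (hι : Function.Injective ι)
    {u : Cone 1} (hu : ι u ≠ 0) : Projectivization.mk ℂ (ι u) hu ∈ linePoints ι hι :=
  ⟨Projectivization.mk ℂ u fun h => hu (by simp [h]), rfl⟩

lemma exists_of_mem_linePoints {n : ℕ} {ι : Cone 1 →ₗ[ℂ] Cone n} {hι : Function.Injective ι}
    {p : PSpace n} (hp : p ∈ linePoints ι hι) :
    ∃ (u : Cone 1) (_ : u ≠ 0) (h : ι u ≠ 0), p = Projectivization.mk ℂ (ι u) h := by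
  obtain ⟨v, rfl⟩ := hp
  induction v with
  | h u hu => exact ⟨u, hu, (map_ne_zero_iff ι hι).2 hu, Projectivization.map_mk ι hι u hu⟩

/-! ### Binary quadratic forms and restriction to a line -/

/-- The binary quadratic form `w₀ X₀² + w₁ X₀ X₁ + w₂ X₁²`. -/
def binaryForm (w : Fin 3 → ℂ) : CoordRing 1 :=
  C (w 0) * X 0 ^ 2 + C (w 1) * (X 0 * X 1) + C (w 2) * X 1 ^ 2

lemma eval_binaryForm (w : Fin 3 → ℂ) (u : Cone 1) :
    eval u (binaryForm w) = w 0 * u 0 ^ 2 + w 1 * (u 0 * u 1) + w 2 * u 1 ^ 2 := by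
  simp [binaryForm]

lemma binaryForm_add (w w' : Fin 3 → ℂ) :
    binaryForm (w + w') = binaryForm w + binaryForm w' := by
  simp only [binaryForm, Pi.add_apply, C_add]
  ring

lemma binaryForm_smul (a : ℂ) (w : Fin 3 → ℂ) : binaryForm (a • w) = C a * binaryForm w := by
  simp only [binaryForm, Pi.smul_apply, smul_eq_mul, C_mul]
  ring

lemma binaryForm_mem_sections (w : Fin 3 → ℂ) : binaryForm w ∈ Sections 1 2 := by
  have h (i j : Fin 2) (a : ℂ) : C a * (X i * X j) ∈ Sections 1 2 :=
    ((isHomogeneous_X ℂ i).mul (isHomogeneous_X ℂ j)).C_mul a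
  simp only [binaryForm, sq]
  exact add_mem (add_mem (h _ _ _) (h _ _ _)) (h _ _ _)

lemma exists_binaryForm_eq {q : CoordRing 1} (hq : q ∈ Sections 1 2) :
    ∃ w, q = binaryForm w := by
  rw [← support_sum_monomial_coeff q]
  refine Finset.sum_induction _ (fun q => ∃ w, q = binaryForm w) ?_ ⟨0, by simp [binaryForm]⟩ ?_
  · rintro _ _ ⟨w, rfl⟩ ⟨w', rfl⟩
    exact ⟨w + w', (binaryForm_add w w').symm⟩
  · intro m hm
    have hdeg : m 0 + m 1 = 2 := by
      by_contra h
      refine (mem_support_iff.1 hm) (IsHomogeneous.coeff_eq_zero hq ?_)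
      rwa [Finsupp.degree_eq_sum, Fin.sum_univ_two]
    have hmon (a : ℂ) : monomial m a = C a * (X 0 ^ m 0 * X 1 ^ m 1) := by
      rw [monomial_eq, Finsupp.prod_fintype _ _ (by simp), Fin.prod_univ_two]
    rw [hmon]
    obtain h | h | h : m 0 = 0 ∨ m 0 = 1 ∨ m 0 = 2 := by omega
    · exact ⟨![0, 0, coeff m q], by simp [binaryForm, h, show m 1 = 2 by omega]⟩
    · exact ⟨![0, coeff m q, 0], by simp [binaryForm, h, show m 1 = 1 by omega]⟩
    · exact ⟨![coeff m q, 0, 0], by simp [binaryForm, h, show m 1 = 0 by omega]⟩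

lemma eval_pullback {n : ℕ} (ι : Cone 1 →ₗ[ℂ] Cone n) (F : CoordRing n) (u : Cone 1) :
    eval u (pullback ι F) = eval (ι u) F := by
  have hu : ι u = fun i => ∑ j, ι (Pi.single j 1) i * u j := by
    ext i
    conv_lhs => rw [pi_eq_sum_univ' u]
    simp [mul_comm]
  induction F using MvPolynomial.induction_on with
  | C a => simp [pullback]
  | add F G hF hG => simp [hF, hG]
  | mul_X F i hF => rw [map_mul, map_mul, hF, map_mul, eval_X, hu]; simp [pullback]

/-- The chain rule for the pull-back along `ι`. -/
lemma pderiv_pullback {n : ℕ} (ι : Cone 1 →ₗ[ℂ] Cone n) (j : Fin 2) (F : CoordRing n) :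
    pderiv j (pullback ι F) = ∑ i, C (ι (Pi.single j 1) i) * pullback ι (pderiv i F) := by
  induction F using MvPolynomial.induction_on with
  | C a => simp [pullback]
  | add F G hF hG => simp [hF, hG, mul_add, Finset.sum_add_distrib]
  | mul_X F k hF =>
    have hX : pderiv j (pullback ι (X k)) = C (ι (Pi.single j 1) k) := by
      fin_cases j <;> simp [pullback, Derivation.leibniz, pderiv_X]
    have h (i : Fin (n + 1)) : C (ι (Pi.single j 1) i) * pullback ι (pderiv i (F * X k)) =
        pullback ι (X k) * (C (ι (Pi.single j 1) i) * pullback ι (pderiv i F)) +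
          (if i = k then pullback ι F * C (ι (Pi.single j 1) i) else 0) := by
      rw [Derivation.leibniz, pderiv_X, map_add, smul_eq_mul, smul_eq_mul, map_mul, map_mul]
      rcases eq_or_ne i k with rfl | hik
      · simp; ring
      · rw [Pi.single_eq_of_ne hik.symm, if_neg hik, map_zero]; ring
    simp only [h, Finset.sum_add_distrib, ← Finset.mul_sum, ← hF]
    rw [map_mul, Derivation.leibniz, hX]
    simp
    ring

/-- The parametrization `(s, t) ↦ s x + t y` of the line through the points `x` and `y`. -/
def lineThrough {n : ℕ} (x y : Cone n) : Cone 1 →ₗ[ℂ] Cone n :=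
  Fintype.linearCombination ℂ ![x, y]

lemma lineThrough_apply {n : ℕ} (x y : Cone n) (u : Cone 1) :
    lineThrough x y u = u 0 • x + u 1 • y := by
  simp [lineThrough, Fintype.linearCombination_apply]

lemma lineThrough_injective {n : ℕ} {x y : Cone n} (h : LinearIndependent ℂ ![x, y]) :
    Function.Injective (lineThrough x y) :=
  linearIndependent_iff_injective_fintypeLinearCombination.1 h

/-! ### Relations between the coefficients of the restricted quadrics -/

/-- The linear relation with coefficients `c` holds between the coefficients of the binary forms
to which the members of `V` restrict on the line parametrized by `ι`. -/
def IsRelation {n : ℕ} (V : Submodule ℂ (Sections n 2)) (ι : Cone 1 →ₗ[ℂ] Cone n)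
    (c : Fin 3 → ℂ) : Prop :=
  ∀ F ∈ V, ∀ w, pullback ι (F : CoordRing n) = binaryForm w → c ⬝ᵥ w = 0

section Relations

variable {n : ℕ} {V : Submodule ℂ (Sections n 2)} {ι : Cone 1 →ₗ[ℂ] Cone n} {c : Fin 3 → ℂ}

lemma isRelation_iff_vanishing (u : Cone 1) :
    IsRelation V ι ![u 0 ^ 2, u 0 * u 1, u 1 ^ 2] ↔
      ∀ F ∈ V, eval (ι u) (F : CoordRing n) = 0 := by
  have key (w : Fin 3 → ℂ) :
      ![u 0 ^ 2, u 0 * u 1, u 1 ^ 2] ⬝ᵥ w = eval u (binaryForm w) := by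
    simp [eval_binaryForm, dotProduct, Fin.sum_univ_three]; ring
  constructor
  · intro h F hF
    obtain ⟨w, hw⟩ := exists_binaryForm_eq (pullback_mem ι F.2)
    rw [← eval_pullback, hw, ← key]
    exact h F hF w hw
  · intro h F hF w hw
    rw [key, ← hw, eval_pullback, h F hF]

/-- Two independent relations confine the restrictions of the members of `V` to the multiples of a
single binary form, given by the cross product of the relations. -/
lemma isSecantLine_of_isRelation {d : Fin 3 → ℂ} (hc : IsRelation V ι c) (hd : IsRelation V ι d)
    (h : c ⨯₃ d ≠ 0) : IsSecantLine (baseScheme V) ι := by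
  set q := c ⨯₃ d with hq
  refine ⟨binaryForm q, binaryForm_mem_sections q, ?_, ?_⟩
  · intro h0
    have hev (u : Cone 1) : q 0 * u 0 ^ 2 + q 1 * (u 0 * u 1) + q 2 * u 1 ^ 2 = 0 := by
      rw [← eval_binaryForm, h0, map_zero]
    have h1 : q 0 = 0 := by simpa using hev ![1, 0]
    have h2 : q 2 = 0 := by simpa using hev ![0, 1]
    have h3 : q 1 = 0 := by simpa [h1, h2] using hev ![1, 1]
    exact h (by ext i; fin_cases i <;> assumption)
  · suffices hle : (baseScheme V).toIdeal ≤
        (Ideal.span {binaryForm q}).comap (pullback ι).toRingHom from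
      fun F hF => Ideal.mem_span_singleton.1 (hle hF)
    refine Ideal.span_le.2 ?_
    rintro _ ⟨G, hG, rfl⟩
    obtain ⟨w, hw⟩ := exists_binaryForm_eq (pullback_mem ι G.2)
    have hcw := hc G hG w hw
    have hdw := hd G hG w hw
    simp only [dotProduct, Fin.sum_univ_three] at hcw hdw
    have q0 : q 0 = c 1 * d 2 - c 2 * d 1 := by simp [hq, cross_apply]
    have q1 : q 1 = c 2 * d 0 - c 0 * d 2 := by simp [hq, cross_apply]
    have q2 : q 2 = c 0 * d 1 - c 1 * d 0 := by simp [hq, cross_apply]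
    -- `w ⨯₃ (c ⨯₃ d) = (w ⬝ d) c - (w ⬝ c) d = 0`, so `w` is parallel to `q`.
    have e01 : w 0 * q 1 = w 1 * q 0 := by
      rw [q0, q1]; linear_combination c 2 * hdw - d 2 * hcw
    have e02 : w 0 * q 2 = w 2 * q 0 := by
      rw [q0, q2]; linear_combination d 1 * hcw - c 1 * hdw
    have e12 : w 1 * q 2 = w 2 * q 1 := by
      rw [q1, q2]; linear_combination c 0 * hdw - d 0 * hcw
    obtain ⟨i, hi⟩ := Function.ne_iff.1 h
    replace hi : q i ≠ 0 := hi
    have hwq : w = (w i / q i) • q := by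
      ext j
      rw [Pi.smul_apply, smul_eq_mul, div_mul_eq_mul_div, eq_div_iff hi]
      fin_cases i <;> fin_cases j <;> simp only [Fin.zero_eta, Fin.mk_one, Fin.reduceFinMk] <;>
        first | rfl | assumption | (symm; assumption)
    change pullback ι G ∈ Ideal.span {binaryForm q}
    rw [hw, hwq, binaryForm_smul]
    exact Ideal.mul_mem_left _ _ (Ideal.mem_span_singleton_self _)

/-- A nonzero relation on the conic is the evaluation at a base point, up to a factor. -/
lemma IsRelation.nondegenerate_of_disjoint (hι : Function.Injective ι)
    (hdis : Disjoint (linePoints ι hι) (points (baseScheme V))) (hc : IsRelation V ι c)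
    (hc0 : c ≠ 0) : c 0 * c 2 ≠ c 1 ^ 2 := by
  intro hdeg
  -- The base point is `(c₀, c₁) = (c₁, c₂)`, in whichever form is nonzero.
  obtain ⟨a, u, hu, hau⟩ : ∃ (a : ℂ) (u : Cone 1), u ≠ 0 ∧
      ![u 0 ^ 2, u 0 * u 1, u 1 ^ 2] = a • c := by
    by_cases h0 : c 0 = 0
    · have h1 : c 1 = 0 := by simpa [h0] using hdeg.symm
      have h2 : c 2 ≠ 0 := fun h2 => hc0 (by ext i; fin_cases i <;> assumption)
      refine ⟨c 2, ![c 1, c 2], fun h => h2 (by simpa using congrFun h 1), ?_⟩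
      ext i; fin_cases i <;> simp [h0, h1, sq]
    · refine ⟨c 0, ![c 0, c 1], fun h => h0 (by simpa using congrFun h 0), ?_⟩
      ext i; fin_cases i <;> simp [sq, hdeg]
  have hrel : IsRelation V ι ![u 0 ^ 2, u 0 * u 1, u 1 ^ 2] := by
    intro F hF w hw
    rw [hau, smul_dotProduct, hc F hF w hw, smul_zero]
  have hιu : ι u ≠ 0 := (map_ne_zero_iff ι hι).2 hu
  exact Set.disjoint_left.1 hdis (mk_mem_linePoints hι hιu)
    ((mk_mem_points_baseScheme hιu).2 ((isRelation_iff_vanishing u).1 hrel))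

/-- A base point on the line is a relation on the conic, hence independent of a relation off the
conic. -/
lemma IsRelation.disjoint (hι : Function.Injective ι) (hc : IsRelation V ι c)
    (hnd : c 0 * c 2 ≠ c 1 ^ 2)
    (hsec : ¬ linePoints ι hι ⊆ secantVariety (baseScheme V)) :
    Disjoint (linePoints ι hι) (points (baseScheme V)) := by
  refine Set.disjoint_left.2 fun p hpL hpX => hsec (linePoints_subset_secantVariety hι ?_)
  obtain ⟨u, hu, hιu, rfl⟩ := exists_of_mem_linePoints hpL
  refine isSecantLine_of_isRelation
    ((isRelation_iff_vanishing u).2 ((mk_mem_points_baseScheme hιu).1 hpX)) hc fun h => ?_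
  have h0 : u 0 * u 1 * c 2 - u 1 ^ 2 * c 1 = 0 := by simpa [cross_apply] using congrFun h 0
  have h1 : u 1 ^ 2 * c 0 - u 0 ^ 2 * c 2 = 0 := by simpa [cross_apply] using congrFun h 1
  have h2 : u 0 ^ 2 * c 1 - u 0 * u 1 * c 0 = 0 := by simpa [cross_apply] using congrFun h 2
  refine hu ?_
  have hD : c 0 * c 2 - c 1 ^ 2 ≠ 0 := sub_ne_zero.2 hnd
  by_contra hu'
  by_cases hu0 : u 0 = 0
  · have hu1 : u 1 ≠ 0 := fun hu1 => hu' (by ext i; fin_cases i <;> assumption)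
    have c1 : c 1 = 0 := by simpa [hu0, hu1] using h0
    have c0 : c 0 = 0 := by simpa [hu0, hu1] using h1
    simp [c0, c1] at hD
  · have e1 : u 0 * c 1 = u 1 * c 0 := mul_left_cancel₀ hu0 (by linear_combination h2)
    have : u 0 ^ 2 * (c 0 * c 2 - c 1 ^ 2) = 0 := by
      linear_combination (-c 0) * h1 - (u 0 * c 1 + u 1 * c 0) * e1
    exact mul_ne_zero (pow_ne_zero 2 hu0) hD this

lemma IsRelation.not_surjective (hc : IsRelation V ι c) (hc0 : c ≠ 0) :
    ¬ Function.Surjective (restrictToLine V ι) := by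
  intro hsurj
  refine hc0 ?_
  ext i
  obtain ⟨F, hF⟩ := hsurj ⟨binaryForm (Pi.single i 1), binaryForm_mem_sections _⟩
  simpa using hc F.1 F.2 (Pi.single i 1) (congrArg Subtype.val hF)

lemma exists_isRelation_of_not_surjective (h : ¬ Function.Surjective (restrictToLine V ι)) :
    ∃ c ≠ 0, IsRelation V ι c := by
  obtain ⟨f, hf0, hf⟩ := Submodule.exists_le_ker_of_lt_top (LinearMap.range (restrictToLine V ι))
    (lt_top_iff_ne_top.2 fun ht => h (LinearMap.range_eq_top.1 ht))
  let e (i : Fin 3) : Sections 1 2 := ⟨binaryForm (Pi.single i 1), binaryForm_mem_sections _⟩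
  have hfw (w : Fin 3 → ℂ) (q : Sections 1 2) (hq : (q : CoordRing 1) = binaryForm w) :
      f q = (fun i => f (e i)) ⬝ᵥ w := by
    have : q = ∑ i, w i • e i := by
      ext1
      rw [hq]
      simp [Fin.sum_univ_three, e, binaryForm, smul_eq_C_mul]
    simp [this, dotProduct, mul_comm]
  refine ⟨fun i => f (e i), fun h0 => hf0 ?_, fun F hF w hw => ?_⟩
  · ext q
    obtain ⟨w, hw⟩ := exists_binaryForm_eq q.2
    rw [hfw w q hw, h0, zero_dotProduct, LinearMap.zero_apply]
  · rw [← hfw w (restrictToLine V ι ⟨F, hF⟩) hw]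
    exact hf ⟨_, rfl⟩

end Relations

/-! ### The map `φ` and its differential along a line -/

lemma phi_mk_eq_of_coneMap_eq_smul {n : ℕ} {V : Submodule ℂ (Sections n 2)} {x y : Cone n}
    (hx : x ≠ 0) (hy : y ≠ 0) (hxX : Projectivization.mk ℂ x hx ∉ points (baseScheme V))
    (hyX : Projectivization.mk ℂ y hy ∉ points (baseScheme V)) {a : ℂ}
    (h : coneMap V x = a • coneMap V y) : phi V ⟨_, hxX⟩ = phi V ⟨_, hyX⟩ := by
  obtain ⟨s, hs⟩ := Projectivization.exists_smul_eq_mk_rep ℂ x hx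
  obtain ⟨t, ht⟩ := Projectivization.exists_smul_eq_mk_rep ℂ y hy
  have hsmul (s : ℂ) (x : Cone n) : coneMap V (s • x) = s ^ 2 • coneMap V x := by
    ext F
    rw [coneMap_apply, eval_smul_of_mem_sections F.1.2, LinearMap.smul_apply, coneMap_apply,
      smul_eq_mul]
  have ht0 : (t : ℂ) ≠ 0 := t.ne_zero
  refine (Projectivization.mk_eq_mk_iff' ℂ _ _ _ _).2 ⟨s ^ 2 * a / t ^ 2, ?_⟩
  simp only [← hs, ← ht, Units.smul_def, hsmul, h, smul_smul]
  congr 1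
  field_simp

/-- The linear map inducing the involution of the line that a relation `c` off the conic defines.
The conjugate of `u` is the point `u'` such that `c` annihilates the binary form with zeros `u` and
`u'`. -/
def conjugation (c : Fin 3 → ℂ) : Cone 1 →ₗ[ℂ] Cone 1 :=
  lineThrough ![c 1, c 2] ![-c 0, -c 1]

lemma conjugation_apply (c : Fin 3 → ℂ) (u : Cone 1) :
    conjugation c u = ![c 1 * u 0 - c 0 * u 1, c 2 * u 0 - c 1 * u 1] := by
  ext i; fin_cases i <;> simp [conjugation, lineThrough_apply] <;> ring

lemma conjugation_conjugation (c : Fin 3 → ℂ) (u : Cone 1) :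
    conjugation c (conjugation c u) = (c 1 ^ 2 - c 0 * c 2) • u := by
  ext i; fin_cases i <;> simp [conjugation_apply] <;> ring

/-- Evaluation of binary forms at the conjugate of `u` is the sum of a multiple of the evaluation at
`u` and a multiple of `c`. -/
lemma IsRelation.coneMap_conjugation {n : ℕ} {V : Submodule ℂ (Sections n 2)}
    {ι : Cone 1 →ₗ[ℂ] Cone n} {c : Fin 3 → ℂ} (hc : IsRelation V ι c) (u : Cone 1) :
    coneMap V (ι (conjugation c u)) = (c 1 ^ 2 - c 0 * c 2) • coneMap V (ι u) := by
  ext G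
  obtain ⟨q, hq⟩ := exists_binaryForm_eq (pullback_mem ι G.1.2)
  have hrel := hc G.1 G.2 q hq
  simp only [dotProduct, Fin.sum_univ_three] at hrel
  rw [LinearMap.smul_apply, coneMap_apply, coneMap_apply, ← eval_pullback ι, ← eval_pullback ι, hq,
    eval_binaryForm, eval_binaryForm, smul_eq_mul, conjugation_apply]
  simp only [Matrix.cons_val_zero, Matrix.cons_val_one]
  linear_combination (c 2 * u 0 ^ 2 - 2 * c 1 * (u 0 * u 1) + c 0 * u 1 ^ 2) * hrel

/-- For a general point `u` of a line, a form `F` that does not vanish on the line vanishes neither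
at `u` nor at its conjugate, and `u` is not its own conjugate: the last condition says that the
binary form `u ∧ σ u`, where `σ` is the conjugation, does not vanish at `u`. -/
lemma exists_eval_conjugation_ne_zero {n d : ℕ} {ι : Cone 1 →ₗ[ℂ] Cone n} {c : Fin 3 → ℂ}
    (hnd : c 0 * c 2 ≠ c 1 ^ 2) {F : CoordRing n} (hF : F ∈ Sections n d) {v : Cone 1}
    (hv : eval (ι v) F ≠ 0) :
    ∃ u : Cone 1, eval (ι u) F ≠ 0 ∧ eval (ι (conjugation c u)) F ≠ 0 ∧
      c 2 * u 0 ^ 2 - 2 * c 1 * (u 0 * u 1) + c 0 * u 1 ^ 2 ≠ 0 := by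
  have hD : c 0 * c 2 - c 1 ^ 2 ≠ 0 := sub_ne_zero.2 hnd
  obtain ⟨f, hf⟩ : ∃ f : CoordRing 1, ∀ u, eval u f = eval (ι u) F :=
    ⟨pullback ι F, eval_pullback ι F⟩
  obtain ⟨g, hg⟩ : ∃ g : CoordRing 1, ∀ u, eval u g = eval (ι (conjugation c u)) F :=
    ⟨pullback (ι ∘ₗ conjugation c) F, eval_pullback _ F⟩
  obtain ⟨w, hw⟩ : ∃ w : CoordRing 1, ∀ u, eval u w =
      c 2 * u 0 ^ 2 - 2 * c 1 * (u 0 * u 1) + c 0 * u 1 ^ 2 :=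
    ⟨binaryForm ![c 2, -2 * c 1, c 0], fun u => by simp [eval_binaryForm]; ring⟩
  have hf0 : f ≠ 0 := fun h => hv (by rw [← hf, h, map_zero])
  have hg0 : g ≠ 0 := by
    intro h
    have := hg (conjugation c v)
    rw [h, map_zero, conjugation_conjugation, map_smul, eval_smul_of_mem_sections hF] at this
    refine mul_ne_zero (pow_ne_zero d fun h => hD ?_) hv this.symm
    linear_combination -h
  have hw0 : w ≠ 0 := by
    intro h
    have hev (u : Cone 1) := (hw u).symm.trans (by rw [h, map_zero])
    have h2 : c 2 = 0 := by simpa using hev ![1, 0]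
    have h0 : c 0 = 0 := by simpa using hev ![0, 1]
    have h1 : c 1 = 0 := by simpa [h0, h2] using hev ![1, 1]
    simp [h1, h2] at hD
  obtain ⟨u, hu⟩ : ∃ u, eval u (f * g * w) ≠ 0 := by
    by_contra! h
    exact mul_ne_zero (mul_ne_zero hf0 hg0) hw0
      (MvPolynomial.funext fun u => by rw [h u, map_zero])
  rw [map_mul, map_mul, hf, hg, hw] at hu
  exact ⟨u, left_ne_zero_of_mul (left_ne_zero_of_mul hu),
    right_ne_zero_of_mul (left_ne_zero_of_mul hu), right_ne_zero_of_mul hu⟩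

/-- A relation off the conic defines an involution of the line, and `φ` identifies the points that
it exchanges. -/
lemma IsRelation.not_injOn {n : ℕ} {V : Submodule ℂ (Sections n 2)} {ι : Cone 1 →ₗ[ℂ] Cone n}
    {c : Fin 3 → ℂ} (hι : Function.Injective ι) (hc : IsRelation V ι c)
    (hnd : c 0 * c 2 ≠ c 1 ^ 2)
    (hsec : ¬ linePoints ι hι ⊆ secantVariety (baseScheme V)) :
    ¬ Set.InjOn (phi V) {p | p.1 ∉ secantVariety (baseScheme V)} := by
  obtain ⟨p, hpL, hpS⟩ := Set.not_subset.1 hsec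
  obtain ⟨v, -, hιv, rfl⟩ := exists_of_mem_linePoints hpL
  -- A form `F` that vanishes on `Sec X` but not on the line.
  obtain ⟨d, F, hF, hFS, hFv⟩ : ∃ (d : ℕ), ∃ F ∈ Sections n d,
      (∀ q ∈ secantVariety (baseScheme V), eval q.rep F = 0) ∧ eval (ι v) F ≠ 0 := by
    simp only [secantVariety, zariskiClosure, Set.mem_ofPred_eq, not_forall] at hpS
    obtain ⟨d, F, hF, hFS, hFp⟩ := hpS
    exact ⟨d, F, hF, fun q hq => hq d F hF hFS,
      fun h => hFp ((eval_rep_mk_eq_zero_iff hF hιv).2 h)⟩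
  obtain ⟨u, hfu, hgu, hwu⟩ := exists_eval_conjugation_ne_zero hnd hF hFv
  have hσu0 : conjugation c u ≠ 0 := by
    intro h
    rw [conjugation_apply] at h
    have h0 : c 1 * u 0 - c 0 * u 1 = 0 := congrFun h 0
    have h1 : c 2 * u 0 - c 1 * u 1 = 0 := congrFun h 1
    exact hwu (by linear_combination u 0 * h1 - u 1 * h0)
  have hu0 : u ≠ 0 := by
    rintro rfl
    exact hσu0 (map_zero _)
  have hx : ι u ≠ 0 := (map_ne_zero_iff ι hι).2 hu0
  have hy : ι (conjugation c u) ≠ 0 := (map_ne_zero_iff ι hι).2 hσu0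
  have hxS : Projectivization.mk ℂ (ι u) hx ∉ secantVariety (baseScheme V) :=
    fun h => hfu ((eval_rep_mk_eq_zero_iff hF hx).1 (hFS _ h))
  have hyS : Projectivization.mk ℂ (ι (conjugation c u)) hy ∉ secantVariety (baseScheme V) :=
    fun h => hgu ((eval_rep_mk_eq_zero_iff hF hy).1 (hFS _ h))
  have hxX : Projectivization.mk ℂ (ι u) hx ∉ points (baseScheme V) :=
    fun h => hxS (points_subset_secantVariety _ h)
  have hyX : Projectivization.mk ℂ (ι (conjugation c u)) hy ∉ points (baseScheme V) :=
    fun h => hyS (points_subset_secantVariety _ h)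
  have hphi : phi V ⟨_, hyX⟩ = phi V ⟨_, hxX⟩ :=
    phi_mk_eq_of_coneMap_eq_smul hy hx hyX hxX (hc.coneMap_conjugation u)
  intro hinj
  have heq : Projectivization.mk ℂ (ι (conjugation c u)) hy = Projectivization.mk ℂ (ι u) hx :=
    congrArg Subtype.val (@hinj ⟨_, hyX⟩ hyS ⟨_, hxX⟩ hxS hphi)
  obtain ⟨a, ha⟩ := (Projectivization.mk_eq_mk_iff' ℂ _ _ hy hx).1 heq
  rw [← map_smul] at ha
  have ha' := (hι ha).trans (conjugation_apply c u)
  have h0 : a * u 0 = c 1 * u 0 - c 0 * u 1 := congrFun ha' 0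
  have h1 : a * u 1 = c 2 * u 0 - c 1 * u 1 := congrFun ha' 1
  exact hwu (by linear_combination u 1 * h0 - u 0 * h1)

/-- Two points with the same image under `φ` give the relation `(1, 0, -a)` on their line. -/
lemma isRelation_of_coneMap_eq_smul {n : ℕ} {V : Submodule ℂ (Sections n 2)} {x y : Cone n}
    {a : ℂ} (h : coneMap V x = a • coneMap V y) :
    IsRelation V (lineThrough x y) ![1, 0, -a] := by
  intro F hF w hw
  have hx : eval x (F : CoordRing n) = w 0 := by
    have := eval_pullback (lineThrough x y) F ![1, 0]
    simpa [hw, eval_binaryForm, lineThrough_apply, eq_comm] using this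
  have hy : eval y (F : CoordRing n) = w 2 := by
    have := eval_pullback (lineThrough x y) F ![0, 1]
    simpa [hw, eval_binaryForm, lineThrough_apply, eq_comm] using this
  have := LinearMap.congr_fun h ⟨F, hF⟩
  rw [LinearMap.smul_apply, coneMap_apply, coneMap_apply, smul_eq_mul, hx, hy] at this
  simp [dotProduct, Fin.sum_univ_three, this]

/-- A tangent vector in the kernel of the differential of `φ` gives the relation `(-a, 1, 0)` on
its line. -/
lemma isRelation_of_coneDeriv_eq_smul {n : ℕ} {V : Submodule ℂ (Sections n 2)} {x y : Cone n}
    {a : ℂ} (h : coneDeriv V x y = a • coneMap V x) :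
    IsRelation V (lineThrough x y) ![-a, 1, 0] := by
  intro F hF w hw
  have hx : eval x (F : CoordRing n) = w 0 := by
    have := eval_pullback (lineThrough x y) F ![1, 0]
    simpa [hw, eval_binaryForm, lineThrough_apply, eq_comm] using this
  have hy : ∑ i, y i * eval x (pderiv i (F : CoordRing n)) = w 1 := by
    have := congrArg (eval ![1, 0]) (pderiv_pullback (lineThrough x y) 1 F)
    rw [hw] at this
    simpa [binaryForm, eval_pullback, lineThrough_apply, Derivation.leibniz, pderiv_X,
      eq_comm] using this
  have := LinearMap.congr_fun h ⟨F, hF⟩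
  rw [LinearMap.smul_apply, coneMap_apply, coneDeriv_apply, smul_eq_mul, hx, hy] at this
  simp [dotProduct, Fin.sum_univ_three, this]

/-- If `r_L` is surjective for all lines `L` that are disjoint from `X` and not contained in
`Sec X`, a line through a point off `Sec X` carries no relation off the conic. -/
lemma not_isRelation_lineThrough {n : ℕ} {V : Submodule ℂ (Sections n 2)}
    (hsurj : ∀ (ι : Cone 1 →ₗ[ℂ] Cone n) (hι : Function.Injective ι),
      Disjoint (linePoints ι hι) (points (baseScheme V)) →
      ¬ linePoints ι hι ⊆ secantVariety (baseScheme V) →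
      Function.Surjective (restrictToLine V ι))
    {p : PSpace n} (hp : p ∉ secantVariety (baseScheme V)) {y : Cone n}
    (hy : LinearIndependent ℂ ![p.rep, y]) {c : Fin 3 → ℂ} (hnd : c 0 * c 2 ≠ c 1 ^ 2) :
    ¬ IsRelation V (lineThrough p.rep y) c := by
  intro hc
  have hι := lineThrough_injective hy
  have hsec : ¬ linePoints (lineThrough p.rep y) hι ⊆ secantVariety (baseScheme V) := by
    refine fun hsub => hp (hsub ?_)
    have h1 : lineThrough p.rep y ![1, 0] = p.rep := by simp [lineThrough_apply]
    have := mk_mem_linePoints hι (u := ![1, 0]) (by rw [h1]; exact p.rep_nonzero)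
    simpa only [h1, Projectivization.mk_rep] using this
  have hc0 : c ≠ 0 := by
    rintro rfl
    simp at hnd
  exact hc.not_surjective hc0 (hsurj _ hι (hc.disjoint hι hnd hsec) hsec)

end QuadricSystem

end

open QuadricSystem in
theorem mainTheorem9 (n : ℕ) (V : Submodule ℂ (QuadricSystem.Sections n 2)) :
    QuadricSystem.IsEmbeddingOff V
        (QuadricSystem.secantVariety (QuadricSystem.baseScheme V)) ↔
      ∀ (ι : QuadricSystem.Cone 1 →ₗ[ℂ] QuadricSystem.Cone n) (hι : Function.Injective ι),
        Disjoint (QuadricSystem.linePoints ι hι)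
            (QuadricSystem.points (QuadricSystem.baseScheme V)) →
        ¬ QuadricSystem.linePoints ι hι ⊆
            QuadricSystem.secantVariety (QuadricSystem.baseScheme V) →
        Function.Surjective (QuadricSystem.restrictToLine V ι) := by
  constructor
  · intro hemb ι hι hdis hsec
    by_contra hns
    obtain ⟨c, hc0, hc⟩ := exists_isRelation_of_not_surjective hns
    exact hc.not_injOn hι (hc.nondegenerate_of_disjoint hι hdis hc0) hsec hemb.1
  · intro hsurj
    refine ⟨fun p hp q hq hpq => ?_, fun p hp => ?_⟩
    · by_contra hne
      obtain ⟨a, ha⟩ := (Projectivization.mk_eq_mk_iff ℂ _ _ (coneMap_ne_zero V p.2)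
        (coneMap_ne_zero V q.2)).1 hpq
      have hind : LinearIndependent ℂ ![p.1.rep, q.1.rep] :=
        Projectivization.linearIndependent_pair_iff_ne.2 fun h => hne (Subtype.ext h)
      exact not_isRelation_lineThrough hsurj hp hind (by simp)
        (isRelation_of_coneMap_eq_smul ha.symm)
    · rw [injective_iff_map_eq_zero]
      intro v hv
      induction v using Submodule.Quotient.induction_on with
      | H v =>
      rw [Submodule.Quotient.mk_eq_zero, Projectivization.submodule_eq]
      have hmem : coneDeriv V p.1.rep v ∈ (phi V p).submodule :=
        (Submodule.Quotient.mk_eq_zero _).1 hv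
      rw [phi, Projectivization.submodule_mk] at hmem
      obtain ⟨a, ha⟩ := Submodule.mem_span_singleton.1 hmem
      by_contra hvp
      have hind : LinearIndependent ℂ ![p.1.rep, v] :=
        (LinearIndependent.pair_iff' p.1.rep_nonzero).2 fun b hb =>
          hvp (Submodule.mem_span_singleton.2 ⟨b, hb⟩)
      exact not_isRelation_lineThrough hsurj hp hind (by simp)
        (isRelation_of_coneDeriv_eq_smul ha.symm)
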